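/- Let $\mathbb N=\{1,2,3,\dots\}$ and let $\ell^2(\mathbb N)$ be the complex Hilbert space of square summable sequences. Consider the lattice evolution system $$2\,\frac{da_n}{dt}=\sqrt{n(n+1)(n+2)}\,a_{n+1}-\sqrt{(n-1)n(n+1)}\,a_{n-1},\qquad n\in\mathbb N, \tag{1}$$ and the Jacobi difference expression $$(Jf)_n=\sqrt{n(n+1)(n+2)}\,f_{n+1}+\sqrt{(n-1)n(n+1)}\,f_{n-1},\qquad n\in\mathbb N .$$ (The term with index $n-1$ is absent for $n=1$.) Under the substitution $a_n=i^nf_n$, system (1) reads $\frac{df}{dt}=\frac i2Jf$. Let $v$ be the real sequence with $Jv=0$ and $v_1=1$, let $$W_n(f,g)=\sqrt{n(n+1)(n+2)}\,(f_ng_{n+1}-f_{n+1}g_n),\qquad n\in\mathbb N,$$ and let $\mathcal J$ be the operator in $\ell^2(\mathbb N)$ that acts as $J$ on the domain $$\mathcal D(v)=\Bigl\{f\in\ell^2(\mathbb N):\ Jf\in\ell^2(\mathbb N),\ \lim_{n\to\infty}W_n(v,f)=0\Bigr\}.$$ By a solution of (1) in $\ell^2(\mathbb N)$ for all $t\in\mathbb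 R$ we mean a mild solution of $\frac{df}{dt}=\frac i2\mathcal Jf$, that is, a continuous map $a:\mathbb R\to\ell^2(\mathbb N)$ such that every component $a_n$ is differentiable on $\mathbb R$ and satisfies (1) for every $t\in\mathbb R$, and such that, with $f_n(t)=i^{-n}a_n(t)$, $$\int_0^t f(s)\,ds\in\mathcal D(v)\qquad\text{for every } t\in\mathbb R .$$ **Theorem.** For every $a(0)\in\ell^2(\mathbb N)$ there exists a unique solution $a(t)\in\ell^2(\mathbb N)$, $t\in\mathbb R$, of (1) with this initial value, and it satisfies $\|a(t)\|_{\ell^2}=\|a(0)\|_{\ell^2}$ for every $t\in\mathbb R$. -/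

import Mathlib

open scoped lp ENNReal

namespace LogKdV

/-- The complex Hilbert space `ℓ²(ℕ)`, where `ℕ = {1, 2, 3, …}`. -/
abbrev Ell2 : Type := lp (fun _ : ℕ+ => ℂ) 2

/-- The weight `√(n(n+1)(n+2))` that couples the sites `n` and `n + 1`. -/
noncomputable def upWeight (n : ℕ+) : ℝ :=
  Real.sqrt ((n : ℝ) * ((n : ℝ) + 1) * ((n : ℝ) + 2))

/-- The weight `√((n-1)n(n+1))` that couples the sites `n` and `n - 1`. It vanishes for `n = 1`,
so that the value of `f (n - 1)` (which for positive naturals is `f 1` if `n = 1`)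
plays no role there. -/
noncomputable def downWeight (n : ℕ+) : ℝ :=
  Real.sqrt (((n : ℝ) - 1) * (n : ℝ) * ((n : ℝ) + 1))

/-- The right-hand side
`√(n(n+1)(n+2)) a_{n+1} - √((n-1)n(n+1)) a_{n-1}` of the skew-symmetric lattice system. -/
noncomputable def latticeRHS (a : ℕ+ → ℂ) (n : ℕ+) : ℂ :=
  (upWeight n : ℂ) * a (n + 1) - (downWeight n : ℂ) * a (n - 1)

/-- The Jacobi difference expression
`(J f)_n = √(n(n+1)(n+2)) f_{n+1} + √((n-1)n(n+1)) f_{n-1}`. -/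
noncomputable def jacobi (f : ℕ+ → ℂ) (n : ℕ+) : ℂ :=
  (upWeight n : ℂ) * f (n + 1) + (downWeight n : ℂ) * f (n - 1)

/-- The discrete Wronskian `W_n(f,g) = √(n(n+1)(n+2)) (f_n g_{n+1} - f_{n+1} g_n)`. -/
noncomputable def wronskian (f g : ℕ+ → ℂ) (n : ℕ+) : ℂ :=
  (upWeight n : ℂ) * (f n * g (n + 1) - f (n + 1) * g n)

/-- The real numbers `v_n` given by `v_1 = 1`, `v_2 = 0` and
`v_{n+2} = - (√n / √(n+3)) v_n` (the value at `0` is a dummy). -/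
noncomputable def nullSeqAux : ℕ → ℝ
  | 0 => 0
  | 1 => 1
  | n + 2 => -(Real.sqrt (n : ℝ) / Real.sqrt ((n : ℝ) + 3)) * nullSeqAux n

/-- The real sequence `v` with `J v = 0` and `v_1 = 1`. -/
noncomputable def nullSeq (n : ℕ+) : ℂ := (nullSeqAux (n : ℕ) : ℂ)

theorem nullSeq_one : nullSeq 1 = 1 := by
  simp [nullSeq, nullSeqAux]

theorem jacobi_nullSeq (n : ℕ+) : jacobi nullSeq n = 0 := by
  obtain ⟨k, rfl⟩ : ∃ k : ℕ, n = k.succPNat := ⟨n.natPred, by simp⟩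
  rcases k with _ | k
  · have h : nullSeq (Nat.succPNat 0 + 1) = 0 := by
      simp [nullSeq, nullSeqAux]
    unfold jacobi
    rw [h]
    simp [downWeight]
  · have h1 : ((k + 1).succPNat - 1 : ℕ+) = k.succPNat := by
      apply PNat.eq
      rw [PNat.sub_coe, if_pos]
      · simp
      · rw [← PNat.coe_lt_coe]; simp
    have h2 : nullSeqAux (k + 3) =
        -(Real.sqrt ((k + 1 : ℕ) : ℝ) / Real.sqrt (((k + 1 : ℕ) : ℝ) + 3)) *
          nullSeqAux (k + 1) := by
      rw [show k + 3 = (k + 1) + 2 from rfl, nullSeqAux]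
    have key : upWeight (k + 1).succPNat * nullSeqAux (k + 3)
        + downWeight (k + 1).succPNat * nullSeqAux (k + 1) = 0 := by
      rw [h2]
      have hk : (0 : ℝ) ≤ k := Nat.cast_nonneg k
      have e1 : upWeight (k + 1).succPNat
          = Real.sqrt (((k : ℝ) + 2) * ((k : ℝ) + 3)) * Real.sqrt ((k : ℝ) + 4) := by
        rw [upWeight, ← Real.sqrt_mul (by positivity)]
        congr 1
        push_cast [Nat.succPNat_coe]
        ring
      have e2 : downWeight (k + 1).succPNat
          = Real.sqrt (((k : ℝ) + 2) * ((k : ℝ) + 3)) * Real.sqrt ((k : ℝ) + 1) := by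
        rw [downWeight, ← Real.sqrt_mul (by positivity)]
        congr 1
        push_cast [Nat.succPNat_coe]
        ring
      have e3 : (((k + 1 : ℕ) : ℝ) + 3) = (k : ℝ) + 4 := by push_cast; ring
      have e4 : ((k + 1 : ℕ) : ℝ) = (k : ℝ) + 1 := by push_cast; ring
      have h4 : Real.sqrt ((k : ℝ) + 4) ≠ 0 := by positivity
      rw [e1, e2, e3, e4]
      field_simp
      ring
    unfold jacobi
    rw [h1]
    have := congrArg (fun x : ℝ => (x : ℂ)) key
    simpa [nullSeq] using this

/-- Membership in the domain
`𝒟(v) = {f ∈ ℓ² : J f ∈ ℓ², W_∞(v,f) = lim W_n(v,f) = 0}` of the Jacobi operator `𝒥`. -/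
def MemJacobiDomain (f : ℕ+ → ℂ) : Prop :=
  Memℓp f 2 ∧ Memℓp (jacobi f) 2 ∧
    Filter.Tendsto (wronskian nullSeq f) Filter.atTop (nhds 0)

/-- The sequence `f` with `a_n = iⁿ f_n`. -/
noncomputable def toJacobi (a : ℕ+ → ℂ) (n : ℕ+) : ℂ := (Complex.I ^ (n : ℕ))⁻¹ * a n

/-- A solution in `ℓ²`, for all `t ∈ ℝ`, of the lattice evolution system, with the boundary
condition at infinity of the Jacobi operator `𝒥`. Initial data are arbitrary in `ℓ²`, so the
solution is understood in the mild sense of semigroup theory: with `a_n(t) = iⁿ f_n(t)`, the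
integral `∫₀ᵗ f(s) ds` lies in `𝒟(v)` and `f(t) - f(0) = (i/2) 𝒥 ∫₀ᵗ f(s) ds`;
the latter identity is the integrated form of the differential equations in `lattice`. -/
structure IsSolution (a : ℝ → Ell2) : Prop where
  continuous : Continuous a
  lattice : ∀ (t : ℝ) (n : ℕ+),
    HasDerivAt (fun s : ℝ => a s n) ((1 / 2 : ℂ) * latticeRHS (a t) n) t
  boundary : ∀ t : ℝ, MemJacobiDomain (toJacobi (∫ s in (0 : ℝ)..t, a s : Ell2))

end LogKdV

/-!
The proof turns the boundary condition at infinity into an orthogonality relation and then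
diagonalizes a compact operator.

Green's formula `∑_{k ≤ n} v_k (J f)_k = W_n(v, f)` (`sum_nullSeq_mul_jacobi`) shows that, for `f`
and `J f` in `ℓ²`, the limit of `W_n(v, f)` is `⟪v, J f⟫` (`tendsto_wronskian`). So `𝒟(v)` consists
of those `f` for which `J f` is orthogonal to `v`. Every sequence annihilated by `J` at all sites
but the first is square summable (`memℓp_of_jacobi_add_one_eq_zero`), because its recursion makes
the sum of squares telescope. This applies to `v` and to the sequence `u` with `u_1 = 0` and
`J u = (1, 0, 0, …)`. The kernel `u_{max(n,k)} v_{min(n,k)}` is therefore real, symmetric and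
Hilbert–Schmidt, and variation of constants shows that its operator `K` is a right inverse of `J`
(`jacobi_greenOperator`). With `P` the orthogonal projection onto `v^⊥`, the compact symmetric
operator `T = P K P` vanishes exactly on the multiples of `v` and describes `𝒥` completely:
`f ∈ 𝒟(v)` and `J f = g` hold iff `⟪v, g⟫ = 0` and `T g = P f`
(`MemJacobiDomain.reducedGreen_eq`, `memJacobiDomain_of_reducedGreen`).

Existence: by the spectral theorem for `T`, multiplication by `exp (i t / (2 μ))` on the eigenspace
for `μ ≠ 0`, and by `1` on the kernel, gives isometries whose orbits `f` are continuous and satisfy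
`T (f t - f 0) = (i / 2) P ∫₀ᵗ f` (`exists_mild_flow`). This need only be verified on
eigenvectors, as they span a dense subspace. The identity is the integrated equation for `𝒥`, and
its components can be differentiated.

Uniqueness: the difference `h` of two solutions with the same initial value satisfies
`T h = (i / 2) H` with `H t = ∫₀ᵗ h`. Then `(‖H‖²)' = 2 Re ⟪H, h⟫ = 2 Re (2 i ⟪T h, h⟫) = 0` as
`⟪T h, h⟫` is real, so that `H = 0` and `h = H' = 0` (`mild_flow_unique`).
-/

namespace LogKdV

/-! ### Compact operators into `ℓ²` -/

theorem norm_inner_le_norm_smul_apply {ι H : Type*} [NormedAddCommGroup H]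
    [InnerProductSpace ℂ H] (r : lp (fun _ : ι => H) 2) (x : H) (i : ι) :
    ‖inner ℂ (r i) x‖ ≤ ‖((‖x‖ : ℂ) • r) i‖ := by
  refine (norm_inner_le_norm (r i) x).trans_eq ?_
  rw [lp.coeFn_smul, Pi.smul_apply, norm_smul, mul_comm]
  simp

/-- A square summable sequence of functionals `⟪r i, ·⟫` defines a bounded operator into `ℓ²`. -/
noncomputable def rowOperator {ι H : Type*} [NormedAddCommGroup H] [InnerProductSpace ℂ H]
    (r : lp (fun _ : ι => H) 2) : H →L[ℂ] lp (fun _ : ι => ℂ) 2 :=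
  LinearMap.mkContinuous
    { toFun := fun x => ⟨fun i => inner ℂ (r i) x,
        (lp.memℓp ((‖x‖ : ℂ) • r)).mono' (norm_inner_le_norm_smul_apply r x)⟩
      map_add' := fun x y => by ext i; exact inner_add_right _ _ _
      map_smul' := fun c x => by ext i; exact inner_smul_right _ _ _ } ‖r‖ fun x =>
    (lp.norm_mono (p := 2) (by simp) (norm_inner_le_norm_smul_apply r x)).trans_eq <| by
      rw [norm_smul, mul_comm]
      simp

theorem rowOperator_apply {ι H : Type*} [NormedAddCommGroup H] [InnerProductSpace ℂ H]
    (r : lp (fun _ : ι => H) 2) (x : H) (i : ι) : rowOperator r x i = inner ℂ (r i) x := rfl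

theorem norm_rowOperator_le {ι H : Type*} [NormedAddCommGroup H] [InnerProductSpace ℂ H]
    (r : lp (fun _ : ι => H) 2) : ‖rowOperator r‖ ≤ ‖r‖ :=
  LinearMap.mkContinuous_norm_le _ (norm_nonneg _) _

/-- A row operator is of Hilbert–Schmidt type: cutting off all but finitely many rows leaves an
operator of finite rank, and the cut-offs converge in operator norm. -/
theorem isCompactOperator_rowOperator {ι H : Type*} [NormedAddCommGroup H]
    [InnerProductSpace ℂ H] (r : lp (fun _ : ι => H) 2) : IsCompactOperator (rowOperator r) := by
  classical
  have hsub (r s : lp (fun _ : ι => H) 2) :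
      rowOperator r - rowOperator s = rowOperator (r - s) := by
    ext x i
    exact (inner_sub_left (𝕜 := ℂ) (r i) (s i) x).symm
  have hsingle (i : ι) (z : H) : rowOperator (lp.single 2 i z) =
      (lp.singleContinuousLinearMap ℂ (fun _ : ι => ℂ) 2 i).comp (innerSL ℂ z) := by
    ext x j
    by_cases h : j = i
    · subst h
      simp [rowOperator_apply]
    · simp [rowOperator_apply, h]
  have hadd (r s : lp (fun _ : ι => H) 2) :
      rowOperator (r + s) = rowOperator r + rowOperator s := by
    ext x i
    exact inner_add_left (𝕜 := ℂ) (r i) (s i) x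
  have hzero : rowOperator (0 : lp (fun _ : ι => H) 2) = 0 := by
    ext x i
    simp [rowOperator_apply]
  have hone (i : ι) (z : H) : IsCompactOperator (rowOperator (lp.single 2 i z)) := by
    rw [hsingle]
    have h : IsCompactOperator (innerSL ℂ z) :=
      isCompactOperator_of_locallyCompactSpace_dom (innerSL ℂ z)
    exact h.clm_comp (lp.singleContinuousLinearMap ℂ (fun _ : ι => ℂ) 2 i)
  have hfin (s : Finset ι) : IsCompactOperator (rowOperator (∑ i ∈ s, lp.single 2 i (r i))) := by
    induction s using Finset.induction_on with
    | empty =>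
      rw [Finset.sum_empty, hzero]
      exact isCompactOperator_zero
    | insert i s hi ih =>
      rw [Finset.sum_insert hi, hadd]
      exact (hone i (r i)).add ih
  have hlim : Filter.Tendsto (fun s : Finset ι => rowOperator (∑ i ∈ s, lp.single 2 i (r i)))
      Filter.atTop (nhds (rowOperator r)) := by
    rw [tendsto_iff_norm_sub_tendsto_zero]
    have h : HasSum (fun i => lp.single 2 i (r i)) r := lp.hasSum_single (by simp) r
    refine squeeze_zero (fun _ => norm_nonneg _) (fun s => ?_)
      (tendsto_iff_norm_sub_tendsto_zero.1 h)
    rw [hsub]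
    exact norm_rowOperator_le _
  exact isCompactOperator_of_tendsto hlim (Filter.Eventually.of_forall hfin)

/-! ### Diagonal isometries -/

/-- Multiplication of the `i`-th component by the unimodular number `c i`. -/
noncomputable def diagonalIsometry {ι : Type*} {E : ι → Type*} [∀ i, NormedAddCommGroup (E i)]
    [∀ i, NormedSpace ℂ (E i)] (c : ι → ℂ) (hc : ∀ i, ‖c i‖ = 1) : lp E 2 →ₗᵢ[ℂ] lp E 2 where
  toFun f := ⟨fun i => c i • f i, (lp.memℓp f).mono' fun i => by simp [norm_smul, hc i]⟩
  map_add' f g := by ext i; exact smul_add _ _ _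
  map_smul' a f := by ext i; exact smul_comm _ _ _
  norm_map' f := by
    refine le_antisymm (lp.norm_mono (p := 2) (by simp) fun i => ?_)
      (lp.norm_mono (p := 2) (by simp) fun i => ?_)
    · exact (by simp [norm_smul, hc i] : ‖c i • f i‖ ≤ ‖f i‖)
    · exact (by simp [norm_smul, hc i] : ‖f i‖ ≤ ‖c i • f i‖)

theorem diagonalIsometry_apply {ι : Type*} {E : ι → Type*} [∀ i, NormedAddCommGroup (E i)]
    [∀ i, NormedSpace ℂ (E i)] (c : ι → ℂ) (hc : ∀ i, ‖c i‖ = 1) (f : lp E 2) (i : ι) :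
    diagonalIsometry c hc f i = c i • f i := rfl

/-! ### The unitary flow generated by the inverse of a compact symmetric operator -/

section Flow

open Module.End

variable {H : Type*} [NormedAddCommGroup H] [InnerProductSpace ℂ H] [CompleteSpace H]

/-- A closed subspace containing all eigenvectors of a compact symmetric operator is everything. -/
theorem eq_top_of_eigenspace_le {T : H →L[ℂ] H} (hT : IsCompactOperator T)
    (hs : (T : H →ₗ[ℂ] H).IsSymmetric) {S : Submodule ℂ H} (hS : IsClosed (S : Set H))
    (h : ∀ μ : ℂ, eigenspace (T : H →ₗ[ℂ] H) μ ≤ S) : S = ⊤ := by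
  rw [← hS.submodule_topologicalClosure_eq, Submodule.topologicalClosure_eq_top_iff, eq_bot_iff,
    ← ContinuousLinearMap.orthogonalComplement_iSup_eigenspaces_eq_bot hT hs]
  exact Submodule.orthogonal_le (iSup_le h)

/-- Unimodular functions of a compact symmetric operator are isometries. -/
theorem exists_isometry_of_eigenspaces {T : H →L[ℂ] H} (hT : IsCompactOperator T)
    (hs : (T : H →ₗ[ℂ] H).IsSymmetric) (c : ℂ → ℂ) (hc : ∀ μ, ‖c μ‖ = 1) :
    ∃ U : H →ₗᵢ[ℂ] H, ∀ μ, ∀ x ∈ eigenspace (T : H →ₗ[ℂ] H) μ, U x = c μ • x := by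
  classical
  have hcl (μ : ℂ) : IsClosed (eigenspace (T : H →ₗ[ℂ] H) μ : Set H) := by
    have : (eigenspace (T : H →ₗ[ℂ] H) μ : Set H) = {x | T x = μ • x} := by
      ext x
      exact mem_eigenspace_iff
    rw [this]
    exact isClosed_eq T.continuous (continuous_const_smul μ)
  have (μ : ℂ) : CompleteSpace (eigenspace (T : H →ₗ[ℂ] H) μ) := (hcl μ).completeSpace_coe
  have hsum := IsHilbertSum.mkInternal (𝕜 := ℂ) (fun μ : ℂ => eigenspace (T : H →ₗ[ℂ] H) μ)
    hs.orthogonalFamily_eigenspaces (eq_top_of_eigenspace_le hT hs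
      (Submodule.isClosed_topologicalClosure _)
      fun μ => (le_iSup _ μ).trans (Submodule.le_topologicalClosure _)).ge
  let e := hsum.linearIsometryEquiv
  refine ⟨e.symm.toLinearIsometry.comp ((diagonalIsometry c hc).comp e.toLinearIsometry), ?_⟩
  intro μ x hx
  have h1 : e.symm (lp.single 2 μ ⟨x, hx⟩) = x :=
    hsum.linearIsometryEquiv_symm_apply_single ⟨x, hx⟩
  have h2 : e x = lp.single 2 μ ⟨x, hx⟩ := by
    rw [← e.symm_apply_eq.1 h1]
  have h3 : diagonalIsometry c hc (e x) = c μ • e x := by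
    rw [h2]
    ext1
    funext ν
    rw [diagonalIsometry_apply, lp.coeFn_smul, Pi.smul_apply]
    by_cases h : ν = μ
    · subst h; rfl
    · rw [lp.single_apply_ne _ _ _ h, smul_zero, smul_zero]
  change e.symm (diagonalIsometry c hc (e x)) = _
  rw [h3, map_smul, e.symm_apply_apply]

/-- Orbits of a family of isometries are continuous if those of eigenvectors are. -/
theorem continuous_orbit_of_eigenspaces {T : H →L[ℂ] H} (hT : IsCompactOperator T)
    (hs : (T : H →ₗ[ℂ] H).IsSymmetric) (U : ℝ → H →ₗᵢ[ℂ] H)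
    (h : ∀ μ, ∀ x ∈ eigenspace (T : H →ₗ[ℂ] H) μ, Continuous fun t => U t x) (x : H) :
    Continuous fun t => U t x := by
  let S : Submodule ℂ H :=
    { carrier := {x | Continuous fun t => U t x}
      add_mem' := fun {x y} hx hy => by
        change Continuous fun t => U t (x + y)
        simp only [map_add]
        exact Continuous.add hx hy
      zero_mem' := by
        change Continuous fun t => U t 0
        simp only [map_zero]
        exact continuous_const
      smul_mem' := fun c x hx => by
        change Continuous fun t => U t (c • x)
        simp only [map_smul]
        exact Continuous.const_smul hx c }
  have hS : IsClosed (S : Set H) := by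
    refine isClosed_of_closure_subset fun x hx => ?_
    refine continuous_of_uniform_approx_of_continuous fun u hu => ?_
    obtain ⟨ε, hε, hεu⟩ := Metric.mem_uniformity_dist.1 hu
    obtain ⟨y, hy, hxy⟩ := Metric.mem_closure_iff.1 hx ε hε
    exact ⟨fun t => U t y, hy, fun t => hεu (by rwa [(U t).dist_map])⟩
  have : S = ⊤ := eq_top_of_eigenspace_le hT hs hS h
  exact (this ▸ Submodule.mem_top : x ∈ S)

/-- The mild flow of the (unbounded) inverse of a compact symmetric operator `T`: on the
eigenspace of `T` for `μ` it is multiplication by `exp (i t / (2 μ))`, and it is constant on the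
kernel of `T`. -/
theorem exists_mild_flow {T : H →L[ℂ] H} (hT : IsCompactOperator T)
    (hs : (T : H →ₗ[ℂ] H).IsSymmetric) (x : H) :
    ∃ f : ℝ → H, Continuous f ∧ f 0 = x ∧ (∀ t, ‖f t‖ = ‖x‖) ∧
      (∀ t z, T z = 0 → inner ℂ z (f t - x) = 0) ∧
      ∀ t, T (T (f t - x) - (Complex.I / 2) • ∫ s in (0 : ℝ)..t, f s) = 0 := by
  -- Eigenvalues are real, and taking real parts makes the phase unimodular for all complex `μ`.
  -- For `μ = 0` the convention `0⁻¹ = 0` gives the constant phase `1`.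
  let c (t : ℝ) (μ : ℂ) : ℂ := Complex.exp ((t * (μ⁻¹).re / 2 : ℝ) * Complex.I)
  have hc (t : ℝ) (μ : ℂ) : ‖c t μ‖ = 1 := Complex.norm_exp_ofReal_mul_I _
  choose U hU using fun t => exists_isometry_of_eigenspaces hT hs (c t) (hc t)
  have hcont (x : H) : Continuous fun t => U t x := by
    refine continuous_orbit_of_eigenspaces hT hs U (fun μ x hx => ?_) x
    simp_rw [fun t => hU t μ x hx, c]
    fun_prop
  have hker {μ : ℂ} {x : H} (hx : x ∈ eigenspace (T : H →ₗ[ℂ] H) μ) : T x = μ • x :=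
    mem_eigenspace_iff.1 hx
  refine ⟨fun t => U t x, hcont x, ?_, fun t => (U t).norm_map x, fun t z hz => ?_, fun t => ?_⟩
  · let S : Submodule ℂ H := ((U 0).toContinuousLinearMap - ContinuousLinearMap.id ℂ H).ker
    have hS : S = ⊤ := by
      refine eq_top_of_eigenspace_le hT hs (ContinuousLinearMap.isClosed_ker _) fun μ y hy => ?_
      simp [S, hU 0 μ y hy, c]
    have : x ∈ S := hS ▸ Submodule.mem_top
    simpa [S, sub_eq_zero] using this
  · let S : Submodule ℂ H :=
      ((innerSL ℂ z).comp ((U t).toContinuousLinearMap - ContinuousLinearMap.id ℂ H)).ker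
    have hS : S = ⊤ := by
      refine eq_top_of_eigenspace_le hT hs (ContinuousLinearMap.isClosed_ker _) fun μ y hy => ?_
      suffices inner ℂ z (U t y - y) = 0 by simpa [S] using this
      rw [hU t μ y hy]
      by_cases hμ : μ = 0
      · simp [hμ, c]
      · have h1 : inner ℂ z (T y) = 0 := by
          have := hs z y
          simp only [ContinuousLinearMap.coe_coe, hz, inner_zero_left] at this
          exact this.symm
        rw [hker hy, inner_smul_right, mul_eq_zero, or_iff_right hμ] at h1
        rw [inner_sub_right, inner_smul_right, h1]
        simp
    exact (hS ▸ Submodule.mem_top : x ∈ S)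
  · have hint (y : H) : IntervalIntegrable (fun s => U s y) MeasureTheory.volume 0 t :=
      (hcont y).intervalIntegrable _ _
    let Φ : H →L[ℂ] H := LinearMap.mkContinuous
      { toFun := fun y => ∫ s in (0 : ℝ)..t, U s y
        map_add' := fun y z => by
          simp only [map_add]
          exact intervalIntegral.integral_add (hint y) (hint z)
        map_smul' := fun a y => by
          simp only [map_smul]
          exact intervalIntegral.integral_smul _ _ } |t| fun y => by
        have := intervalIntegral.norm_integral_le_of_norm_le_const (a := 0) (b := t)
          (f := fun s => U s y) (C := ‖y‖) fun s _ => ((U s).norm_map y).le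
        rw [mul_comm]
        simpa using this
    let S : Submodule ℂ H := (T.comp (T.comp
      ((U t).toContinuousLinearMap - ContinuousLinearMap.id ℂ H) - (Complex.I / 2) • Φ)).ker
    have hS : S = ⊤ := by
      refine eq_top_of_eigenspace_le hT hs (ContinuousLinearMap.isClosed_ker _) fun μ y hy => ?_
      change T (T (U t y - y) - (Complex.I / 2) • ∫ s in (0 : ℝ)..t, U s y) = 0
      simp_rw [fun s => hU s μ y hy]
      rw [intervalIntegral.integral_smul_const]
      by_cases hμ : μ = 0
      · simp [hμ, c, hker hy]
      · by_cases hy0 : y = 0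
        · simp [hy0]
        have hreal : ((μ.re : ℝ) : ℂ) = μ :=
          Complex.conj_eq_iff_re.1 (hs.conj_eigenvalue_eq_self
            (hasEigenvalue_of_hasEigenvector ⟨hy, hy0⟩))
        obtain ⟨m, rfl⟩ : ∃ m : ℝ, μ = m := ⟨_, hreal.symm⟩
        have hm : (m : ℂ) ≠ 0 := hμ
        have hI : ∫ s in (0 : ℝ)..t, c s m =
            (c t m - 1) / (Complex.I / (2 * m)) := by
          have h := integral_exp_mul_complex (a := 0) (b := t) (c := Complex.I / (2 * m))
            (by simp [hm])
          have hcs (s : ℝ) : c s m = Complex.exp (Complex.I / (2 * m) * s) := by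
            simp only [c]
            congr 1
            rw [← Complex.ofReal_inv, Complex.ofReal_re]
            push_cast
            field_simp
          simp_rw [hcs]
          rw [h]
          simp
        rw [hI, map_sub T (c t m • y), map_smul, hker hy, smul_smul, smul_smul, ← sub_smul,
          ← sub_smul]
        rw [show c t m * (m : ℂ) - m - Complex.I / 2 * ((c t m - 1) / (Complex.I / (2 * m))) = 0 by
          field_simp [Complex.I_ne_zero]
          ring]
        simp
    exact (hS ▸ Submodule.mem_top : x ∈ S)

/-- Mild solutions with vanishing initial value vanish: the primitive `∫ h` has constant norm,
since `⟪T y, y⟫` is real. -/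
theorem mild_flow_unique {T : H →L[ℂ] H} (hs : (T : H →ₗ[ℂ] H).IsSymmetric) {h : ℝ → H}
    (hcont : Continuous h)
    (hT : ∀ t, T (h t) = (Complex.I / 2) • ∫ s in (0 : ℝ)..t, h s) (t : ℝ) : h t = 0 := by
  let F (t : ℝ) : H := ∫ s in (0 : ℝ)..t, h s
  have hF (t : ℝ) : HasDerivAt F (h t) t :=
    intervalIntegral.integral_hasDerivAt_right (hcont.intervalIntegrable _ _)
      (hcont.stronglyMeasurableAtFilter _ _) hcont.continuousAt
  have hFT (t : ℝ) : F t = (-2 * Complex.I) • T (h t) := by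
    rw [hT, smul_smul]
    ring_nf
    simp [F]
  have hreal (y : H) : (inner ℂ (T y) y).im = 0 := by
    have h1 : (starRingEnd ℂ) (inner ℂ (T y) y) = inner ℂ (T y) y := by
      rw [inner_conj_symm]
      exact (hs y y).symm
    exact Complex.conj_eq_iff_im.1 h1
  have hd (t : ℝ) : HasDerivAt (fun t => inner ℂ (F t) (F t)) 0 t := by
    convert! (hF t).inner ℂ (hF t) using 1
    rw [← inner_conj_symm (h t) (F t), hFT t, inner_smul_left]
    apply Complex.ext <;> simp [hreal, -inner_conj_symm]
  have hF0 (t : ℝ) : F t = 0 := by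
    have h1 := is_const_of_deriv_eq_zero (fun t => (hd t).differentiableAt)
      (fun t => (hd t).deriv) t 0
    have h2 : F 0 = 0 := intervalIntegral.integral_same
    rw [h2, inner_zero_left] at h1
    exact inner_self_eq_zero.1 h1
  have h1 : F = fun _ => 0 := funext hF0
  have h2 := hF t
  rw [h1] at h2
  exact h2.unique (hasDerivAt_const t 0)

end Flow

/-! ### The Jacobi difference expression -/

theorem upWeight_pos (n : ℕ+) : 0 < upWeight n := by
  have : (0 : ℝ) < n := by exact_mod_cast n.pos
  unfold upWeight
  positivity

theorem upWeight_ne_zero (n : ℕ+) : (upWeight n : ℂ) ≠ 0 :=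
  Complex.ofReal_ne_zero.2 (upWeight_pos n).ne'

theorem downWeight_one : downWeight 1 = 0 := by simp [downWeight]

theorem downWeight_add_one (n : ℕ+) : downWeight (n + 1) = upWeight n := by
  unfold downWeight upWeight
  congr 1
  push_cast
  ring

theorem jacobi_one (f : ℕ+ → ℂ) : jacobi f 1 = upWeight 1 * f (1 + 1) := by
  simp [jacobi, downWeight_one]

theorem jacobi_add_one (f : ℕ+ → ℂ) (n : ℕ+) :
    jacobi f (n + 1) = upWeight (n + 1) * f (n + 1 + 1) + upWeight n * f n := by
  rw [jacobi, downWeight_add_one, PNat.add_sub]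

theorem jacobi_sub_const_mul (f g : ℕ+ → ℂ) (c : ℂ) (n : ℕ+) :
    jacobi (fun k => f k - c * g k) n = jacobi f n - c * jacobi g n := by
  simp only [jacobi]
  ring

theorem sum_Ico_one_add_one {M : Type*} [AddCommMonoid M] (x : ℕ+ → M) (n : ℕ+) :
    ∑ k ∈ Finset.Ico 1 (n + 1), x k = ∑ k ∈ Finset.Ico 1 n, x k + x n := by
  have : Finset.Ico 1 (n + 1) = insert n (Finset.Ico 1 n) := by
    ext k
    simp only [Finset.mem_Ico, Finset.mem_insert, PNat.lt_add_one_iff, one_le, true_and]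
    exact le_iff_eq_or_lt
  rw [this, Finset.sum_insert (by simp), add_comm]

/-- Green's formula for `J` and the zero solution `v`. -/
theorem sum_nullSeq_mul_jacobi (f : ℕ+ → ℂ) (n : ℕ+) :
    ∑ k ∈ Finset.Ico 1 (n + 1), nullSeq k * jacobi f k = wronskian nullSeq f n := by
  induction n using PNat.recOn with
  | one =>
    have h := jacobi_nullSeq 1
    rw [jacobi_one] at h
    rw [sum_Ico_one_add_one, jacobi_one, wronskian]
    simp only [Finset.Ico_self, Finset.sum_empty]
    linear_combination f 1 * h
  | succ n ih =>
    have h := jacobi_nullSeq (n + 1)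
    rw [jacobi_add_one] at h
    rw [sum_Ico_one_add_one, ih, jacobi_add_one, wronskian, wronskian]
    linear_combination f (n + 1) * h

theorem eq_mul_nullSeq_of_jacobi_eq_zero {f : ℕ+ → ℂ} (hf : ∀ n, jacobi f n = 0) (n : ℕ+) :
    f n = f 1 * nullSeq n := by
  -- The difference vanishes at the first site, and the recursion propagates this.
  let g (k : ℕ+) : ℂ := f k - f 1 * nullSeq k
  have hg (k : ℕ+) : jacobi g k = 0 := by
    rw [jacobi_sub_const_mul, hf, jacobi_nullSeq, mul_zero, sub_zero]
  suffices g n = 0 ∧ g (n + 1) = 0 from sub_eq_zero.1 this.1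
  induction n using PNat.recOn with
  | one =>
    refine ⟨by simp [g, nullSeq_one], ?_⟩
    have h := hg 1
    rw [jacobi_one] at h
    exact (mul_eq_zero.1 h).resolve_left (upWeight_ne_zero 1)
  | succ n ih =>
    refine ⟨ih.2, ?_⟩
    have h := hg (n + 1)
    rw [jacobi_add_one, ih.1, mul_zero, add_zero] at h
    exact (mul_eq_zero.1 h).resolve_left (upWeight_ne_zero _)

/-- The limit-circle property of `J` at infinity. For `x n = ‖f n‖ ^ 2` the recursion reads
`x (n + 2) = n * x n - (n + 2) * x (n + 2)`, so that the sum of `x` telescopes. -/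
theorem memℓp_of_jacobi_add_one_eq_zero {f : ℕ+ → ℂ} (hf : ∀ n, jacobi f (n + 1) = 0) :
    Memℓp f 2 := by
  have hw (n : ℕ+) : upWeight n ^ 2 = (n : ℝ) * (n + 1) * (n + 2) := by
    rw [upWeight, Real.sq_sqrt (by positivity)]
  have hrec (n : ℕ+) : ((n : ℝ) + 3) * ‖f (n + 1 + 1)‖ ^ 2 = n * ‖f n‖ ^ 2 := by
    have h := hf n
    rw [jacobi_add_one] at h
    have h1 : upWeight (n + 1) ^ 2 * ‖f (n + 1 + 1)‖ ^ 2 = upWeight n ^ 2 * ‖f n‖ ^ 2 := by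
      have := congrArg (fun z => ‖z‖ ^ 2) (eq_neg_of_add_eq_zero_left h)
      simpa [mul_pow] using this
    rw [hw, hw] at h1
    push_cast at h1
    have h2 : ((n : ℝ) + 1) * (n + 2) ≠ 0 := by positivity
    apply mul_left_cancel₀ h2
    linear_combination h1
  have hsum (n : ℕ+) : ∑ k ∈ Finset.Ico 1 (n + 1 + 1), ‖f k‖ ^ 2 + n * ‖f n‖ ^ 2
      + (n + 1) * ‖f (n + 1)‖ ^ 2 = 2 * ‖f 1‖ ^ 2 + 3 * ‖f (1 + 1)‖ ^ 2 := by
    induction n using PNat.recOn with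
    | one =>
      rw [sum_Ico_one_add_one, sum_Ico_one_add_one]
      simp
      ring
    | succ n ih =>
      rw [← ih, sum_Ico_one_add_one _ (n + 1 + 1)]
      push_cast
      linear_combination hrec n
  refine memℓp_gen' (C := 2 * ‖f 1‖ ^ 2 + 3 * ‖f (1 + 1)‖ ^ 2) fun s => ?_
  obtain ⟨N, hN⟩ := s.bddAbove
  have hsub : s ⊆ Finset.Ico 1 (N + 1 + 1) := fun k hk => by
    have h1 : k ≤ N := hN hk
    exact Finset.mem_Ico.2 ⟨one_le, PNat.lt_add_one_iff.2 (h1.trans (PNat.lt_add_right N 1).le)⟩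
  have h2 : ∑ k ∈ s, ‖f k‖ ^ (2 : ℝ≥0∞).toReal = ∑ k ∈ s, ‖f k‖ ^ 2 := by simp
  rw [h2, ← hsum N]
  have h3 := Finset.sum_le_sum_of_subset_of_nonneg (f := fun k => ‖f k‖ ^ 2) hsub
    fun k _ _ => by positivity
  have h4 : 0 ≤ (N : ℝ) * ‖f N‖ ^ 2 + (N + 1) * ‖f (N + 1)‖ ^ 2 := by positivity
  linarith

/-! ### Green's operator -/

/-- The values `u (k + 1)`, `k = 0, 1, …`, of the sequence `pointSeq`, which is indexed from `1`. -/
noncomputable def pointSeqAux : ℕ → ℝ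
  | 0 => 0
  | 1 => (upWeight 1)⁻¹
  | k + 2 => -(upWeight k.succPNat / upWeight (k + 1).succPNat) * pointSeqAux k

/-- The real sequence `u` with `u 1 = 0` for which `J u` is the unit vector at `1`. -/
noncomputable def pointSeq (n : ℕ+) : ℂ := (pointSeqAux n.natPred : ℂ)

theorem jacobi_pointSeq_one : jacobi pointSeq 1 = 1 := by
  have h : pointSeq (1 + 1) = (upWeight 1 : ℂ)⁻¹ := by
    change ((pointSeqAux 1 : ℝ) : ℂ) = _
    simp [pointSeqAux]
  rw [jacobi_one, h, mul_inv_cancel₀ (upWeight_ne_zero 1)]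

theorem jacobi_pointSeq_add_one (n : ℕ+) : jacobi pointSeq (n + 1) = 0 := by
  obtain ⟨k, rfl⟩ : ∃ k : ℕ, n = k.succPNat := ⟨n.natPred, by simp⟩
  have h : pointSeq (k.succPNat + 1 + 1) =
      -(upWeight k.succPNat / upWeight (k.succPNat + 1)) * pointSeq k.succPNat := by
    change ((pointSeqAux (k + 2) : ℝ) : ℂ) =
      -(upWeight k.succPNat / upWeight (k + 1).succPNat) * (pointSeqAux k : ℂ)
    simp [pointSeqAux]
  rw [jacobi_add_one, h]
  have hw := upWeight_ne_zero (k.succPNat + 1)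
  field_simp
  ring

theorem memℓp_pointSeq : Memℓp pointSeq 2 :=
  memℓp_of_jacobi_add_one_eq_zero jacobi_pointSeq_add_one

theorem memℓp_nullSeq : Memℓp nullSeq 2 :=
  memℓp_of_jacobi_add_one_eq_zero fun n => jacobi_nullSeq (n + 1)

/-- The sequence `u` as a vector in `ℓ²`. -/
noncomputable def pointVec : Ell2 := ⟨pointSeq, memℓp_pointSeq⟩

/-- The sequence `v` as a vector in `ℓ²`. -/
noncomputable def nullVec : Ell2 := ⟨nullSeq, memℓp_nullSeq⟩

theorem pointVec_apply (n : ℕ+) : pointVec n = pointSeq n := rfl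

theorem nullVec_apply (n : ℕ+) : nullVec n = nullSeq n := rfl

theorem conj_pointSeq (n : ℕ+) : starRingEnd ℂ (pointSeq n) = pointSeq n := Complex.conj_ofReal _

theorem conj_nullSeq (n : ℕ+) : starRingEnd ℂ (nullSeq n) = nullSeq n := Complex.conj_ofReal _

/-- By Green's formula the Wronskian of `v` and `u` is the partial sum of `v k * (J u) k`, whose
only nonzero term is `v 1 = 1`. -/
theorem wronskian_nullSeq_pointSeq (n : ℕ+) : wronskian nullSeq pointSeq n = 1 := by
  induction n using PNat.recOn with
  | one =>
    rw [← sum_nullSeq_mul_jacobi, sum_Ico_one_add_one, jacobi_pointSeq_one, nullSeq_one]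
    simp
  | succ n ih =>
    rw [← sum_nullSeq_mul_jacobi, sum_Ico_one_add_one, sum_nullSeq_mul_jacobi, ih,
      jacobi_pointSeq_add_one, mul_zero, add_zero]

/-- Restriction of a vector to a set of sites. -/
noncomputable def cutoff (s : Set ℕ+) (f : Ell2) : Ell2 :=
  ⟨s.indicator f, (lp.memℓp f).mono' fun _ => norm_indicator_le_norm_self _ _⟩

theorem cutoff_apply (s : Set ℕ+) (f : Ell2) (n : ℕ+) : cutoff s f n = s.indicator f n := rfl

theorem norm_cutoff_le (s : Set ℕ+) (f : Ell2) : ‖cutoff s f‖ ≤ ‖f‖ :=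
  lp.norm_mono (p := 2) (by simp) fun _ => norm_indicator_le_norm_self _ _

theorem cutoff_empty (f : Ell2) : cutoff ∅ f = 0 := by
  ext n
  simp [cutoff_apply]

theorem cutoff_insert {s : Set ℕ+} {n : ℕ+} (hn : n ∉ s) (f : Ell2) :
    cutoff (insert n s) f = cutoff s f + lp.single 2 n (f n) := by
  ext k
  rw [lp.coeFn_add, Pi.add_apply, cutoff_apply, cutoff_apply]
  by_cases hk : k = n
  · subst hk
    rw [lp.single_apply_self]
    simp [hn]
  · rw [lp.single_apply_ne _ _ _ hk]
    by_cases hs : k ∈ s <;> simp [hk, hs]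

/-- The `n`-th row of the kernel `u (max n k) * v (min n k)`. -/
noncomputable def greenRow (n : ℕ+) : Ell2 :=
  pointSeq n • cutoff (Set.Iio n) nullVec + nullSeq n • cutoff (Set.Ici n) pointVec

theorem greenRow_apply (n k : ℕ+) :
    greenRow n k = pointSeq (max n k) * nullSeq (min n k) := by
  rw [greenRow, lp.coeFn_add, Pi.add_apply, lp.coeFn_smul, lp.coeFn_smul, Pi.smul_apply,
    Pi.smul_apply, cutoff_apply, cutoff_apply]
  rcases lt_or_ge k n with h | h
  · simp [h, h.le, h.not_ge, nullVec_apply]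
  · simp [h, h.not_gt, pointVec_apply, mul_comm]

theorem memℓp_greenRow : Memℓp greenRow 2 := by
  have h : Memℓp (fun n => ‖nullVec‖ * ‖pointSeq n‖ + ‖pointVec‖ * ‖nullSeq n‖) 2 :=
    (memℓp_pointSeq.norm.const_mul _).add (memℓp_nullSeq.norm.const_mul _)
  refine h.mono fun n => (norm_add_le _ _).trans ?_
  rw [norm_smul, norm_smul, mul_comm ‖pointSeq n‖, mul_comm ‖nullSeq n‖]
  gcongr <;> exact norm_cutoff_le _ _

/-- The integral operator on `ℓ²` with the real symmetric kernel `u (max n k) * v (min n k)`. -/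
noncomputable def greenOperator : Ell2 →L[ℂ] Ell2 :=
  rowOperator (⟨greenRow, memℓp_greenRow⟩ : lp (fun _ : ℕ+ => Ell2) 2)

theorem isCompactOperator_greenOperator : IsCompactOperator greenOperator :=
  isCompactOperator_rowOperator _

theorem greenOperator_apply (g : Ell2) (n : ℕ+) : greenOperator g n =
    pointSeq n * inner ℂ (cutoff (Set.Iio n) nullVec) g +
      nullSeq n * inner ℂ (cutoff (Set.Ici n) pointVec) g := by
  change inner ℂ (greenRow n) g = _
  rw [greenRow, inner_add_left, inner_smul_left, inner_smul_left, conj_pointSeq, conj_nullSeq]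

/-- Symmetry is checked on the unit vectors, where it is the symmetry of the kernel. -/
theorem isSymmetric_greenOperator : (greenOperator : Ell2 →ₗ[ℂ] Ell2).IsSymmetric := by
  rw [← ContinuousLinearMap.isSelfAdjoint_iff_isSymmetric]
  change ContinuousLinearMap.adjoint greenOperator = greenOperator
  refine lp.ext_continuousLinearMap (by simp) fun j => ?_
  ext i
  have hrow (i j : ℕ+) (a : ℂ) : greenOperator (lp.single 2 j a) i =
      pointSeq (max i j) * nullSeq (min i j) * a := by
    change inner ℂ (greenRow i) (lp.single 2 j a) = _
    rw [lp.inner_single_right, greenRow_apply]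
    simp [conj_pointSeq, conj_nullSeq, mul_comm]
  change (ContinuousLinearMap.adjoint greenOperator (lp.single 2 j 1)) i =
    greenOperator (lp.single 2 j 1) i
  have h : inner ℂ (lp.single 2 i (1 : ℂ) : Ell2)
      (ContinuousLinearMap.adjoint greenOperator (lp.single 2 j 1)) =
      ContinuousLinearMap.adjoint greenOperator (lp.single 2 j 1) i := by
    rw [lp.inner_single_left]
    simp
  rw [← h, ContinuousLinearMap.adjoint_inner_right, lp.inner_single_right, hrow, hrow]
  simp [conj_pointSeq, conj_nullSeq, max_comm, min_comm]

/-- Variation of constants: Green's operator is a right inverse of `J`. -/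
theorem jacobi_greenOperator (g : Ell2) (n : ℕ+) : jacobi (greenOperator g) n = g n := by
  let A (n : ℕ+) : ℂ := inner ℂ (cutoff (Set.Iio n) nullVec) g
  let B (n : ℕ+) : ℂ := inner ℂ (cutoff (Set.Ici n) pointVec) g
  have hA1 : A 1 = 0 := by
    have : Set.Iio (1 : ℕ+) = ∅ := by ext; simp
    simp only [A, this, cutoff_empty, inner_zero_left]
  have hA (n : ℕ+) : A (n + 1) = A n + nullSeq n * g n := by
    have : Set.Iio (n + 1) = insert n (Set.Iio n) := by
      ext k
      simp [le_iff_eq_or_lt]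
    simp only [A]
    rw [this, cutoff_insert (by simp), inner_add_left, lp.inner_single_left]
    simp [nullVec_apply, conj_nullSeq, mul_comm]
  have hB (n : ℕ+) : B n = B (n + 1) + pointSeq n * g n := by
    have : Set.Ici n = insert n (Set.Ici (n + 1)) := by
      ext k
      simp only [Set.mem_Ici, Set.mem_insert_iff, PNat.add_one_le_iff]
      rw [le_iff_eq_or_lt, eq_comm]
    simp only [B]
    rw [this, cutoff_insert (by simp), inner_add_left, lp.inner_single_left]
    simp [pointVec_apply, conj_pointSeq, mul_comm]
  have hG (n : ℕ+) : greenOperator g n = pointSeq n * A n + nullSeq n * B n :=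
    greenOperator_apply g n
  have hW (n : ℕ+) := wronskian_nullSeq_pointSeq n
  simp only [wronskian] at hW
  induction n using PNat.recOn with
  | one =>
    have hv := jacobi_nullSeq 1
    rw [jacobi_one] at hv
    rw [jacobi_one, hG, hA, hA1]
    linear_combination g 1 * hW 1 + B 1 * hv - upWeight 1 * nullSeq (1 + 1) * hB 1
  | succ n =>
    have hv := jacobi_nullSeq (n + 1)
    rw [jacobi_add_one] at hv
    have hu := jacobi_pointSeq_add_one n
    rw [jacobi_add_one] at hu
    rw [jacobi_add_one, hG, hG, hB n, hA (n + 1)]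
    linear_combination g (n + 1) * hW (n + 1) + B (n + 1) * hv + A (n + 1) * hu
      - upWeight (n + 1) * nullSeq (n + 1 + 1) * hB (n + 1) - upWeight n * pointSeq n * hA n

/-! ### The Jacobi operator through its compact inverse -/

/-- The orthogonal projection onto the complement of `v`. -/
noncomputable def nullProj : Ell2 →L[ℂ] Ell2 := (ℂ ∙ nullVec)ᗮ.starProjection

theorem nullProj_eq_self_iff {x : Ell2} : nullProj x = x ↔ inner ℂ nullVec x = 0 := by
  rw [nullProj, Submodule.starProjection_eq_self_iff,
    Submodule.mem_orthogonal_singleton_iff_inner_right]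

theorem nullProj_eq_zero_iff {x : Ell2} : nullProj x = 0 ↔ ∃ c : ℂ, c • nullVec = x := by
  rw [nullProj, Submodule.starProjection_apply_eq_zero_iff, Submodule.orthogonal_orthogonal,
    Submodule.mem_span_singleton]

theorem inner_nullVec_nullProj (x : Ell2) : inner ℂ nullVec (nullProj x) = 0 :=
  Submodule.mem_orthogonal_singleton_iff_inner_right.1 (Submodule.starProjection_apply_mem _ x)

theorem nullProj_nullProj (x : Ell2) : nullProj (nullProj x) = nullProj x :=
  nullProj_eq_self_iff.2 (inner_nullVec_nullProj x)

theorem nullProj_nullVec : nullProj nullVec = 0 :=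
  nullProj_eq_zero_iff.2 ⟨1, one_smul _ _⟩

/-- Green's operator compressed to the complement of `v`. It inverts the Jacobi operator `𝒥`
there. -/
noncomputable def reducedGreen : Ell2 →L[ℂ] Ell2 := nullProj ∘L greenOperator ∘L nullProj

theorem reducedGreen_apply (x : Ell2) :
    reducedGreen x = nullProj (greenOperator (nullProj x)) := rfl

theorem isCompactOperator_reducedGreen : IsCompactOperator reducedGreen :=
  (isCompactOperator_greenOperator.comp_clm nullProj).clm_comp nullProj

theorem isSymmetric_reducedGreen : (reducedGreen : Ell2 →ₗ[ℂ] Ell2).IsSymmetric := by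
  intro x y
  have hP (x y : Ell2) : inner ℂ (nullProj x) y = inner ℂ x (nullProj y) :=
    Submodule.starProjection_isSymmetric (K := (ℂ ∙ nullVec)ᗮ) x y
  change inner ℂ (nullProj (greenOperator (nullProj x))) y =
    inner ℂ x (nullProj (greenOperator (nullProj y)))
  rw [hP]
  refine Eq.trans ?_ (hP _ _)
  exact isSymmetric_greenOperator _ _

theorem reducedGreen_nullVec : reducedGreen nullVec = 0 := by
  rw [reducedGreen_apply, nullProj_nullVec, map_zero, map_zero]

theorem nullProj_reducedGreen (x : Ell2) : nullProj (reducedGreen x) = reducedGreen x :=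
  nullProj_nullProj _

/-- The vectors annihilated by the reduced Green's operator are the multiples of `v`. -/
theorem nullProj_eq_zero_of_reducedGreen_eq_zero {x : Ell2} (hx : reducedGreen x = 0) :
    nullProj x = 0 := by
  obtain ⟨c, hc⟩ := nullProj_eq_zero_iff.1 (reducedGreen_apply x ▸ hx)
  ext n
  have h := jacobi_greenOperator (nullProj x) n
  rw [← hc] at h
  have h0 : jacobi (fun k => 0 - (-c) * nullSeq k) n = 0 := by
    rw [jacobi_sub_const_mul (fun _ => 0), jacobi_nullSeq]
    simp [jacobi]
  rw [← h, lp.coeFn_zero, Pi.zero_apply, ← h0]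
  congr 1
  funext k
  rw [zero_sub, neg_mul, neg_neg]
  rfl

/-- On the domain of `𝒥` the limit of the Wronskian is `⟪v, J f⟫`. Hence the range of `𝒥` is
orthogonal to `v`. -/
theorem tendsto_wronskian {f : ℕ+ → ℂ} {g : Ell2} (hg : ∀ n, jacobi f n = g n) :
    Filter.Tendsto (wronskian nullSeq f) Filter.atTop (nhds (inner ℂ nullVec g)) := by
  have h : HasSum (fun k => nullSeq k * jacobi f k) (inner ℂ nullVec g) := by
    convert! lp.hasSum_inner (𝕜 := ℂ) nullVec g using 2 with k
    simp [hg, nullVec_apply, conj_nullSeq, mul_comm]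
  have hlim : Filter.Tendsto (fun n : ℕ+ => Finset.Ico 1 (n + 1)) Filter.atTop Filter.atTop := by
    refine Filter.tendsto_atTop_finset_of_monotone (fun m n hmn => ?_) fun k => ?_
    · exact Finset.Ico_subset_Ico_right (by gcongr)
    · exact ⟨k, Finset.mem_Ico.2 ⟨one_le, PNat.lt_add_right k 1⟩⟩
  refine (h.comp hlim).congr fun n => ?_
  exact sum_nullSeq_mul_jacobi f n

/-- The graph of `𝒥` in terms of the reduced Green's operator, forward direction. -/
theorem MemJacobiDomain.reducedGreen_eq {F G : Ell2} (hF : MemJacobiDomain F)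
    (hG : ∀ n, jacobi F n = G n) :
    inner ℂ nullVec G = 0 ∧ reducedGreen G = nullProj F := by
  have h0 : inner ℂ nullVec G = 0 := tendsto_nhds_unique (tendsto_wronskian hG) hF.2.2
  refine ⟨h0, ?_⟩
  rw [reducedGreen_apply, nullProj_eq_self_iff.2 h0, ← sub_eq_zero, ← map_sub,
    nullProj_eq_zero_iff]
  let f (n : ℕ+) : ℂ := greenOperator G n - 1 * F n
  have hf (n : ℕ+) : jacobi f n = 0 := by
    rw [jacobi_sub_const_mul, jacobi_greenOperator, hG, one_mul, sub_self]
  refine ⟨f 1, ?_⟩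
  ext n
  have h := eq_mul_nullSeq_of_jacobi_eq_zero hf n
  have hn : f n = (greenOperator G - F) n := by simp [f]
  rw [← hn, h]
  rfl

/-- The graph of `𝒥` in terms of the reduced Green's operator, backward direction. -/
theorem memJacobiDomain_of_reducedGreen {F G : Ell2} (h0 : inner ℂ nullVec G = 0)
    (hGF : reducedGreen G = nullProj F) : MemJacobiDomain F ∧ ∀ n, jacobi F n = G n := by
  rw [reducedGreen_apply, nullProj_eq_self_iff.2 h0, ← sub_eq_zero, ← map_sub,
    nullProj_eq_zero_iff] at hGF
  obtain ⟨c, hc⟩ := hGF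
  have hF : (F : ℕ+ → ℂ) = fun n => greenOperator G n - c * nullSeq n := by
    funext n
    have := congrArg (fun f : Ell2 => f n) hc
    simp only [lp.coeFn_smul, lp.coeFn_sub, Pi.smul_apply, Pi.sub_apply, nullVec_apply,
      smul_eq_mul] at this
    linear_combination this
  have hJ (n : ℕ+) : jacobi F n = G n := by
    rw [hF, jacobi_sub_const_mul, jacobi_greenOperator, jacobi_nullSeq, mul_zero, sub_zero]
  refine ⟨⟨lp.memℓp F, ?_, ?_⟩, hJ⟩
  · rw [funext hJ]
    exact lp.memℓp G
  · rw [← h0]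
    exact tendsto_wronskian hJ

/-! ### Passage between the two forms of the system -/

/-- The isometry `a ↦ f` with `a n = iⁿ f n`. -/
noncomputable def toJacobiVec : Ell2 →ₗᵢ[ℂ] Ell2 :=
  diagonalIsometry (fun n : ℕ+ => (Complex.I ^ (n : ℕ))⁻¹) fun n => by simp

/-- The isometry `f ↦ a` with `a n = iⁿ f n`. -/
noncomputable def ofJacobiVec : Ell2 →ₗᵢ[ℂ] Ell2 :=
  diagonalIsometry (fun n : ℕ+ => Complex.I ^ (n : ℕ)) fun n => by simp

theorem coe_toJacobiVec (a : Ell2) : (toJacobiVec a : ℕ+ → ℂ) = toJacobi a := rfl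

theorem toJacobiVec_apply (a : Ell2) (n : ℕ+) :
    toJacobiVec a n = (Complex.I ^ (n : ℕ))⁻¹ * a n := rfl

theorem ofJacobiVec_apply (f : Ell2) (n : ℕ+) : ofJacobiVec f n = Complex.I ^ (n : ℕ) * f n := rfl

theorem toJacobiVec_ofJacobiVec (f : Ell2) : toJacobiVec (ofJacobiVec f) = f := by
  ext n
  simp [toJacobiVec_apply, ofJacobiVec_apply]

theorem ofJacobiVec_toJacobiVec (a : Ell2) : ofJacobiVec (toJacobiVec a) = a := by
  ext n
  simp [toJacobiVec_apply, ofJacobiVec_apply]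

theorem latticeRHS_ofJacobiVec (f : Ell2) (n : ℕ+) :
    latticeRHS (ofJacobiVec f) n = Complex.I ^ (n : ℕ) * (Complex.I * jacobi f n) := by
  induction n using PNat.recOn with
  | one =>
    simp only [latticeRHS, jacobi, downWeight_one, ofJacobiVec_apply, PNat.add_coe, PNat.one_coe,
      Complex.ofReal_zero, zero_mul]
    ring
  | succ n =>
    simp only [latticeRHS, jacobi, ofJacobiVec_apply, PNat.add_sub]
    simp only [PNat.add_coe, PNat.one_coe, pow_succ]
    linear_combination (-(downWeight (n + 1) : ℂ) * Complex.I ^ (n : ℕ) * f n) * Complex.I_sq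

theorem hasDerivAt_apply {f : ℝ → Ell2} {f' : Ell2} {t : ℝ} (h : HasDerivAt f f' t) (n : ℕ+) :
    HasDerivAt (fun s => f s n) (f' n) t :=
  (lp.evalCLM ℂ (fun _ : ℕ+ => ℂ) 2 n).restrictScalars ℝ |>.hasFDerivAt.comp_hasDerivAt t h

theorem hasDerivAt_integral {f : ℝ → Ell2} (hf : Continuous f) (t : ℝ) :
    HasDerivAt (fun t => ∫ s in (0 : ℝ)..t, f s) (f t) t :=
  intervalIntegral.integral_hasDerivAt_right (hf.intervalIntegrable _ _)
    (hf.stronglyMeasurableAtFilter _ _) hf.continuousAt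

/-- The components of `J ∫ f` are primitives of those of `J f`. -/
theorem hasDerivAt_jacobi_integral {f : ℝ → Ell2} (hf : Continuous f) (t : ℝ) (n : ℕ+) :
    HasDerivAt (fun t => jacobi (∫ s in (0 : ℝ)..t, f s : Ell2) n) (jacobi (f t) n) t := by
  have h (k : ℕ+) := hasDerivAt_apply (hasDerivAt_integral hf t) k
  exact ((h (n + 1)).const_mul _).add ((h (n - 1)).const_mul _)

/-- Integrated form of the evolution equation in terms of the reduced Green's operator. -/
theorem IsSolution.integrated {a : ℝ → Ell2} (ha : IsSolution a) (t : ℝ) :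
    inner ℂ nullVec (toJacobiVec (a t) - toJacobiVec (a 0)) = 0 ∧
      reducedGreen (toJacobiVec (a t) - toJacobiVec (a 0)) =
        (Complex.I / 2) • nullProj (∫ s in (0 : ℝ)..t, toJacobiVec (a s)) := by
  let f (t : ℝ) : Ell2 := toJacobiVec (a t)
  have hf : Continuous f := toJacobiVec.continuous.comp ha.continuous
  have hfd (n : ℕ+) (t : ℝ) :
      HasDerivAt (fun s => f s n) (Complex.I / 2 * jacobi (f t) n) t := by
    convert! (ha.lattice t n).const_mul (Complex.I ^ (n : ℕ))⁻¹ using 1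
    have h := latticeRHS_ofJacobiVec (f t) n
    rw [show ofJacobiVec (f t) = a t from ofJacobiVec_toJacobiVec _] at h
    rw [h]
    field_simp
  have hint (n : ℕ+) (t : ℝ) :
      f t n - f 0 n = Complex.I / 2 * jacobi (∫ s in (0 : ℝ)..t, f s : Ell2) n := by
    have hd (t : ℝ) := (hfd n t).sub ((hasDerivAt_jacobi_integral hf t n).const_mul (Complex.I / 2))
    have h := is_const_of_deriv_eq_zero (fun t => (hd t).differentiableAt)
      (fun t => (hd t).deriv.trans (sub_self _)) t 0
    have h0 : jacobi (0 : Ell2) n = 0 := by simp [jacobi]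
    simp only [Pi.sub_apply, intervalIntegral.integral_same, h0, mul_zero, sub_zero] at h
    linear_combination h
  have hdom : MemJacobiDomain (∫ s in (0 : ℝ)..t, f s : Ell2) := by
    have h := ha.boundary t
    rwa [← coe_toJacobiVec, ← toJacobiVec.intervalIntegral_comp_comm] at h
  have hsmul : f t - f 0 = (Complex.I / 2) • ((-2 * Complex.I) • (f t - f 0)) := by
    rw [smul_smul]
    ring_nf
    simp
  obtain ⟨h1, h2⟩ := hdom.reducedGreen_eq (G := (-2 * Complex.I) • (f t - f 0)) fun n => by
    have h := hint n t
    simp only [lp.coeFn_smul, lp.coeFn_sub, Pi.smul_apply, Pi.sub_apply, smul_eq_mul, h]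
    linear_combination (jacobi (∫ s in (0 : ℝ)..t, f s : Ell2) n) * Complex.I_sq
  change inner ℂ nullVec (f t - f 0) = 0 ∧ reducedGreen (f t - f 0) = _
  rw [hsmul]
  exact ⟨by rw [inner_smul_right, h1, mul_zero], by rw [map_smul, h2]⟩

/-- The mild flow for the reduced Green's operator, transported back by `a n = iⁿ f n`, solves the
lattice system: with `F = ∫ f` it yields `F ∈ 𝒟(v)` and `J F = -2 i (f t - f 0)`, and the latter
identity can be differentiated in every component. -/
theorem exists_isSolution (a₀ : Ell2) :
    ∃ a : ℝ → Ell2, IsSolution a ∧ a 0 = a₀ ∧ ∀ t, ‖a t‖ = ‖a₀‖ := by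
  obtain ⟨f, hf, hf0, hnorm, hker, hflow⟩ := exists_mild_flow isCompactOperator_reducedGreen
    isSymmetric_reducedGreen (toJacobiVec a₀)
  have hdom (t : ℝ) := memJacobiDomain_of_reducedGreen (F := ∫ s in (0 : ℝ)..t, f s)
    (G := (-2 * Complex.I) • (f t - toJacobiVec a₀))
    (by rw [inner_smul_right, hker t nullVec reducedGreen_nullVec, mul_zero]) <| by
      have h := nullProj_eq_zero_of_reducedGreen_eq_zero (hflow t)
      rw [map_sub, map_smul, nullProj_reducedGreen, sub_eq_zero] at h
      have hI : -2 * Complex.I * (Complex.I / 2) = 1 := by linear_combination -Complex.I_sq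
      rw [map_smul, h, smul_smul, hI]
      exact one_smul ℂ _
  have hcomp (n : ℕ+) (t : ℝ) : f t n = toJacobiVec a₀ n
      + Complex.I / 2 * jacobi (∫ s in (0 : ℝ)..t, f s : Ell2) n := by
    rw [(hdom t).2 n]
    simp only [lp.coeFn_smul, lp.coeFn_sub, Pi.smul_apply, Pi.sub_apply, smul_eq_mul]
    linear_combination (f t n - toJacobiVec a₀ n) * Complex.I_sq
  refine ⟨fun t => ofJacobiVec (f t), ⟨ofJacobiVec.continuous.comp hf, fun t n => ?_, fun t => ?_⟩,
    ?_, fun t => ?_⟩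
  · have h : HasDerivAt (fun s => f s n) (Complex.I / 2 * jacobi (f t) n) t := by
      simp_rw [hcomp n]
      exact ((hasDerivAt_jacobi_integral hf t n).const_mul _).const_add _
    convert! h.const_mul (Complex.I ^ (n : ℕ)) using 1
    rw [latticeRHS_ofJacobiVec]
    ring
  · rw [← coe_toJacobiVec, ofJacobiVec.intervalIntegral_comp_comm, toJacobiVec_ofJacobiVec]
    exact (hdom t).1
  · change ofJacobiVec (f 0) = a₀
    rw [hf0, ofJacobiVec_toJacobiVec]
  · rw [ofJacobiVec.norm_map, hnorm, toJacobiVec.norm_map]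

/-- The difference of two solutions with equal initial values stays orthogonal to `v`, so that the
reduced Green's operator controls all of it. -/
theorem IsSolution.eq_of_initial_eq {a b : ℝ → Ell2} (ha : IsSolution a) (hb : IsSolution b)
    (h0 : a 0 = b 0) : a = b := by
  let d (t : ℝ) : Ell2 := toJacobiVec (a t) - toJacobiVec (b t)
  have hca : Continuous fun t => toJacobiVec (a t) := toJacobiVec.continuous.comp ha.continuous
  have hcb : Continuous fun t => toJacobiVec (b t) := toJacobiVec.continuous.comp hb.continuous
  have hd : Continuous d := hca.sub hcb
  have hsub (t : ℝ) : d t = (toJacobiVec (a t) - toJacobiVec (a 0))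
      - (toJacobiVec (b t) - toJacobiVec (b 0)) := by
    rw [h0, sub_sub_sub_cancel_right]
  have hPd (t : ℝ) : nullProj (d t) = d t := by
    rw [nullProj_eq_self_iff, hsub, inner_sub_right, (ha.integrated t).1, (hb.integrated t).1,
      sub_zero]
  have hT (t : ℝ) : reducedGreen (d t) = (Complex.I / 2) • ∫ s in (0 : ℝ)..t, d s := by
    rw [hsub, map_sub, (ha.integrated t).2, (hb.integrated t).2, ← smul_sub, ← map_sub,
      ← intervalIntegral.integral_sub (hca.intervalIntegrable _ _) (hcb.intervalIntegrable _ _),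
      ← nullProj.intervalIntegral_comp_comm (hd.intervalIntegrable _ _)]
    simp_rw [hPd]
  funext t
  exact toJacobiVec.injective
    (sub_eq_zero.1 (mild_flow_unique isSymmetric_reducedGreen hd hT t))

end LogKdV

theorem mainTheorem4 (a₀ : LogKdV.Ell2) :
    ∃ a : ℝ → LogKdV.Ell2,
      LogKdV.IsSolution a ∧ a 0 = a₀ ∧ (∀ t : ℝ, ‖a t‖ = ‖a₀‖) ∧
      ∀ b : ℝ → LogKdV.Ell2, LogKdV.IsSolution b → b 0 = a₀ → b = a := by
  obtain ⟨a, ha, ha0, hnorm⟩ := LogKdV.exists_isSolution a₀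
  exact ⟨a, ha, ha0, hnorm, fun b hb hb0 => hb.eq_of_initial_eq ha (hb0.trans ha0.symm)⟩
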